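/- Let $\mathcal H$ be a real separable Hilbert space with its Borel $\sigma$-algebra and $(\Omega,\mathcal F,\mathbb P)$ a probability space. Let $f:\mathcal H\to\mathbb R$ be convex and differentiable, with $L$-Lipschitz continuous gradient ($L>0$) and $\operatorname{argmin} f\neq\emptyset$. Let $\alpha\in[0,1[$ and let $(s_k)_{k\in\mathbb N}$ be a non-increasing sequence in $]0,1/L]$. Let $y_0$ be a square-integrable $\mathcal H$-valued random variable, let $(e_k)_{k\in\mathbb N}$ be integrable $\mathcal H$-valued random variables, put $w_{-1}:=y_0$, and let $(y_k,w_k)$ be generated by the stochastic Ravine accelerated gradient method with constant extrapolation coefficient $\alpha$: for all $k\ge 0$, $$w_k=y_k-s_k\bigl(\nabla f(y_k)+e_k\bigr),\qquad y_{k+1}=w_k+\alpha\,(w_k-w_{k-1}).$$ Let $\mathcal F_k:=\sigma(y_0,w_0,\dots,w_{k-1})$ and $\sigma_k:=\mathbb E[\|e_k\|^2\mid\mathcal F_k]^{1/2}$, where the conditional expectation of the nonnegative variable $\|e_k\|^2$ is taken with values in $[0,+\infty]$. Assume that for every $k$ $$\mathbb E[e_k\mid\mathcal F_k]=0\ \text{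 almost surely},\qquad\text{and that}\qquad \sum_{k\in\mathbb N}s_k\sigma_k<+\infty\ \text{ almost surely}.$$ Then: (i) almost surely, $\displaystyle\sum_{k\ge 0}s_k\bigl(f(y_k)-\min_{\mathcal H}f\bigr)<+\infty$ and $\displaystyle\sum_{k\ge 1}\|y_k-y_{k-1}\|^2<+\infty$; (ii) if moreover $\inf_k s_k>0$, then almost surely $\displaystyle\sum_{k\ge 0}\|\nabla f(y_k)\|^2<+\infty$, and there is a random variable $X$ with values in $\operatorname{argmin} f$ such that almost surely $(y_k)$ converges weakly to $X$. -/

import Mathlib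

open MeasureTheory ProbabilityTheory Filter Topology
open scoped ENNReal NNReal

/-- The set of global minimizers of `f`. -/
def argminSet {H : Type*} (f : H → ℝ) : Set H :=
  {x | ∀ z, f x ≤ f z}

/-- The infimum of `f`; it is the minimum of `f` as soon as `argminSet f` is nonempty. -/
noncomputable def minValue {H : Type*} (f : H → ℝ) : ℝ :=
  ⨅ x, f x

/-- The iterate with index `k - 1`: it is `w (k - 1)` for `k ≥ 1`, and the initial value
`w_{-1} = y₀` for `k = 0`. -/
def prevIterate {H : Type*} (y₀ : H) (w : ℕ → H) : ℕ → H
  | 0 => y₀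
  | k + 1 => w k

/-- `(y, w)` is a trajectory of the Ravine accelerated gradient method for `f`, with step sizes
`s`, extrapolation coefficients `α` (the coefficient used at iteration `k` being `α (k + 1)`) and
gradient errors `e`, started at `y 0` with `w_{-1} = y 0`. -/
structure IsRavineTrajectory {H : Type*} [NormedAddCommGroup H] [InnerProductSpace ℝ H]
    [CompleteSpace H] (f : H → ℝ) (s α : ℕ → ℝ) (e y w : ℕ → H) : Prop where
  gradient_step : ∀ k, w k = y k - s k • (gradient f (y k) + e k)
  extrapolation : ∀ k, y (k + 1) = w k + α (k + 1) • (w k - prevIterate (y 0) w k)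

/-- The canonical filtration of the method: `ℱ k` is the σ-algebra on `Ω` generated by `y₀` and
`w 0, …, w (k - 1)`. -/
abbrev ravineSigma {Ω H : Type*} [MeasurableSpace H] (y₀ : Ω → H) (w : ℕ → Ω → H) (k : ℕ) :
    MeasurableSpace Ω :=
  MeasurableSpace.comap y₀ inferInstance ⊔
    ⨆ i : Fin k, MeasurableSpace.comap (w i) inferInstance

/-- The conditional standard deviation `𝔼[‖e‖² | m]^(1/2)` of a random vector with conditional mean
zero. The conditional expectation of the nonnegative variable `‖e‖²` is taken with values in
`[0, ∞]`, so that it exists without any integrability of `‖e‖²`. -/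
noncomputable def condStd {Ω H : Type*} {mΩ : MeasurableSpace Ω} [NormedAddCommGroup H]
    (P : Measure Ω) (m : MeasurableSpace Ω) (e : Ω → H) : Ω → ℝ≥0∞ :=
  fun ω => (condLExp m P (fun ω' => ‖e ω'‖ₑ ^ 2) ω) ^ (1 / 2 : ℝ)

/-- Weak convergence of a sequence in a real Hilbert space: convergence for the weak topology. -/
def WeaklyConverges {H : Type*} [NormedAddCommGroup H] [InnerProductSpace ℝ H]
    (u : ℕ → H) (x : H) : Prop :=
  Tendsto (fun k => toWeakSpace ℝ H (u k)) atTop (𝓝 (toWeakSpace ℝ H x))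

/-! ### Smooth convex analysis: the two first-order inequalities and weak closedness. -/

section Convex

variable {H : Type*} [NormedAddCommGroup H] [InnerProductSpace ℝ H] [CompleteSpace H]

/-! Put x_k = w_{k-1} and d_k = x_k - x_{k-1} (with d_0 = 0). The method becomes a heavy-ball-like
recursion whose gradient g_k is taken at y_k = x_k + α d_k (`IsInertialPath`).

Suppose first that ∑ s_k² E‖e_k‖² is finite. The energy s_k (f(x_k) - min f) + ½‖d_k‖² dissipates (1
- α²)/2 ‖d_k‖² per step, up to a mean-zero noise term and ‖s_k e_k‖² (`energy_step`), so ∑ E‖d_k‖²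
is finite. The point p_k = x_k + α/(1-α) d_k moves by exactly -(s_k/(1-α))(g_k + e_k), and p_k - y_k
is a multiple of d_k. Hence ‖p_k - z‖² is a quasi-Fejér process for every minimizer z, with errors
already known to be summable (`anchor_step`). Taking expectations makes the gaps s_k (f(y_k) - min
f) summable; supermartingale convergence gives a limit of ‖p_k - z‖² (`IsInertialPath.ae_anchor`).

In general the errors need not be square-integrable. Each e_k is cut off by an event of ℱ_k on which
the accumulated conditional variances stay below N. The truncated errors are again conditionally
centred and fall under the first case; almost every path agrees with a truncated one for some N
(`IsInertialPath.ae_hasFejerBounds_of_condStd`).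

When the steps are bounded below, f(y_k) tends to min f, and `opial` applied to p_k, together with
d_k → 0, gives weak convergence of y_k. -/

theorem hasDerivAt_comp_line {f : H → ℝ} (hf : Differentiable ℝ f) (x v : H) (t : ℝ) :
    HasDerivAt (fun t : ℝ => f (x + t • v)) (inner ℝ (gradient f (x + t • v)) v) t := by
  have h1 : HasDerivAt (fun t : ℝ => x + t • v) v t := by
    simpa using ((hasDerivAt_id t).smul_const v).const_add x
  have h2 := (hf (x + t • v)).hasFDerivAt.comp_hasDerivAt t h1
  rw [gradient, InnerProductSpace.toDual_symm_apply]
  exact h2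

/-- First-order lower bound for a differentiable convex function. -/
theorem ConvexOn.add_inner_gradient_le {f : H → ℝ} (hconv : ConvexOn ℝ Set.univ f)
    (hf : Differentiable ℝ f) (x y : H) :
    f x + inner ℝ (gradient f x) (y - x) ≤ f y := by
  have hc : ConvexOn ℝ Set.univ (fun t : ℝ => f (x + t • (y - x))) := by
    have := hconv.comp_affineMap (AffineMap.lineMap (k := ℝ) x y)
    refine (this.congr ?_ : ConvexOn ℝ Set.univ _)
    intro t _
    simp [AffineMap.lineMap_apply, add_comm]
  have hd := hasDerivAt_comp_line hf x (y - x) 0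
  have := hc.le_slope_of_hasDerivAt (Set.mem_univ 0) (Set.mem_univ 1) one_pos hd
  simp only [slope_def_field, zero_smul, add_zero, one_smul, add_sub_cancel, sub_zero, div_one]
    at this
  linarith

/-- The descent lemma. -/
theorem LipschitzWith.descent {f : H → ℝ} {L : ℝ≥0} (hf : Differentiable ℝ f)
    (hlip : LipschitzWith L (gradient f)) (x y : H) :
    f y ≤ f x + inner ℝ (gradient f x) (y - x) + L / 2 * ‖y - x‖ ^ 2 := by
  set v := y - x with hv
  have hd : ∀ t : ℝ, HasDerivAt (fun t : ℝ => f (x + t • v) -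
      t * inner ℝ (gradient f x) v - L / 2 * ‖v‖ ^ 2 * t ^ 2)
      (inner ℝ (gradient f (x + t • v)) v - inner ℝ (gradient f x) v - L * ‖v‖ ^ 2 * t) t := by
    intro t
    have h := ((hasDerivAt_comp_line hf x v t).sub
      ((hasDerivAt_id t).mul_const (inner ℝ (gradient f x) v))).sub
      ((hasDerivAt_pow 2 t).const_mul (L / 2 * ‖v‖ ^ 2))
    refine h.congr_deriv ?_
    simp; ring
  -- The Lipschitz bound makes the derivative nonpositive; comparing t = 0 with t = 1 is the claim.
  have hanti : AntitoneOn (fun t : ℝ => f (x + t • v) -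
      t * inner ℝ (gradient f x) v - L / 2 * ‖v‖ ^ 2 * t ^ 2) (Set.Icc 0 1) := by
    refine antitoneOn_of_deriv_nonpos (convex_Icc 0 1)
      (fun t _ => (hd t).continuousAt.continuousWithinAt)
      (fun t _ => (hd t).differentiableAt.differentiableWithinAt) ?_
    intro t ht
    rw [interior_Icc] at ht
    rw [(hd t).deriv, ← inner_sub_left]
    have h1 := real_inner_le_norm (gradient f (x + t • v) - gradient f x) v
    have h2 := hlip.dist_le_mul (x + t • v) x
    rw [dist_eq_norm, dist_eq_norm, add_sub_cancel_left, norm_smul, Real.norm_of_nonneg ht.1.le]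
      at h2
    nlinarith [norm_nonneg v, mul_le_mul_of_nonneg_right h2 (norm_nonneg v)]
  have := hanti (Set.left_mem_Icc.2 zero_le_one) (Set.right_mem_Icc.2 zero_le_one) zero_le_one
  simp only [zero_smul, add_zero, one_smul, zero_mul, sub_zero, one_mul, hv, add_sub_cancel,
    one_pow, mul_one, ne_eq, OfNat.ofNat_ne_zero, not_false_eq_true, zero_pow, mul_zero] at this
  rw [hv]
  linarith

theorem gradient_eq_zero_of_mem_argminSet {f : H → ℝ} {z : H} (hz : z ∈ argminSet f) :
    gradient f z = 0 := by
  have h : IsLocalMin f z := Filter.Eventually.of_forall hz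
  rw [gradient, h.fderiv_eq_zero, map_zero]

omit [InnerProductSpace ℝ H] [CompleteSpace H] in
theorem minValue_eq_of_mem_argminSet {f : H → ℝ} {z : H} (hz : z ∈ argminSet f) :
    minValue f = f z :=
  le_antisymm (ciInf_le ⟨f z, by rintro _ ⟨x, rfl⟩; exact hz x⟩ z) (le_ciInf hz)

/-- A weak limit of a minimizing sequence is a minimizer. -/
theorem mem_argminSet_of_weak_limit {f : H → ℝ} (hconv : ConvexOn ℝ Set.univ f)
    (hf : Differentiable ℝ f) {z : H} (hz : z ∈ argminSet f) {u : ℕ → H} {x : H}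
    (hu : ∀ h, Tendsto (fun k => inner ℝ (u k) h) atTop (𝓝 (inner ℝ x h)))
    (hfu : Tendsto (fun k => f (u k)) atTop (𝓝 (f z))) : x ∈ argminSet f := by
  -- The affine minorant of `f` at `x` is weakly continuous and lies below `f (u k)`.
  have h1 : Tendsto (fun k => f x + inner ℝ (gradient f x) (u k - x)) atTop (𝓝 (f x)) := by
    have := ((hu (gradient f x)).sub_const (inner ℝ x (gradient f x))).const_add (f x)
    simp only [sub_self, add_zero] at this
    refine this.congr fun k => ?_
    rw [← inner_sub_left, real_inner_comm]
  have h2 : f x ≤ f z :=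
    le_of_tendsto_of_tendsto' h1 hfu fun k => hconv.add_inner_gradient_le hf x (u k)
  exact fun w => h2.trans (hz w)

end Convex

/-! ### Weak convergence, Opial's lemma, measurability of weak limits. -/

section Weak

variable {H : Type*} [NormedAddCommGroup H] [InnerProductSpace ℝ H] [CompleteSpace H]

theorem weaklyConverges_iff_forall_inner {u : ℕ → H} {x : H} :
    WeaklyConverges u x ↔ ∀ h, Tendsto (fun k => inner ℝ (u k) h) atTop (𝓝 (inner ℝ x h)) := by
  have hinj : Function.Injective (topDualPairing ℝ H).flip := by
    intro a b hab
    refine ext_inner_left ℝ fun v => ?_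
    exact LinearMap.congr_fun hab (InnerProductSpace.toDual ℝ H v)
  have key : WeaklyConverges u x ↔ ∀ φ : StrongDual ℝ H,
      Tendsto (fun k => φ (u k)) atTop (𝓝 (φ x)) :=
    WeakBilin.tendsto_iff_forall_eval_tendsto _ hinj
  rw [key]
  constructor
  · intro h v
    simpa [real_inner_comm] using h (InnerProductSpace.toDual ℝ H v)
  · intro h φ
    have e : ∀ v, φ v = inner ℝ v ((InnerProductSpace.toDual ℝ H).symm φ) := fun v => by
      rw [real_inner_comm, InnerProductSpace.toDual_symm_apply]
    simp only [e]
    exact h _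

/-- Bounded sequences in a separable Hilbert space have weakly convergent subsequences. -/
theorem exists_weak_limit_subseq [TopologicalSpace.SeparableSpace H] {u : ℕ → H} {C : ℝ}
    (hu : ∀ k, ‖u k‖ ≤ C) :
    ∃ (x : H) (φ : ℕ → ℕ), StrictMono φ ∧
      ∀ h, Tendsto (fun k => inner ℝ (u (φ k)) h) atTop (𝓝 (inner ℝ x h)) := by
  obtain ⟨a, -, φ, hφ, hlim⟩ := WeakDual.isSeqCompact_closedBall ℝ H 0 C
    (x := fun k => StrongDual.toWeakDual (InnerProductSpace.toDual ℝ H (u k))) (fun k => by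
      simpa using hu k)
  refine ⟨(InnerProductSpace.toDual ℝ H).symm (WeakDual.toStrongDual a), φ, hφ, fun h => ?_⟩
  rw [InnerProductSpace.toDual_symm_apply]
  exact tendsto_iff_forall_eval_tendsto_topDualPairing.1 hlim h

/-- **Opial's lemma**. -/
theorem opial [TopologicalSpace.SeparableSpace H] {u : ℕ → H} {S : Set H} (hS : S.Nonempty)
    (hlim : ∀ z ∈ S, ∃ l, Tendsto (fun k => ‖u k - z‖ ^ 2) atTop (𝓝 l))
    (hclus : ∀ (x : H) (φ : ℕ → ℕ), Tendsto φ atTop atTop →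
      (∀ h, Tendsto (fun k => inner ℝ (u (φ k)) h) atTop (𝓝 (inner ℝ x h))) → x ∈ S) :
    ∃ x ∈ S, ∀ h, Tendsto (fun k => inner ℝ (u k) h) atTop (𝓝 (inner ℝ x h)) := by
  obtain ⟨C, hC⟩ : ∃ C, ∀ k, ‖u k‖ ≤ C := by
    obtain ⟨z, hz⟩ := hS
    obtain ⟨l, hl⟩ := hlim z hz
    obtain ⟨B, hB⟩ := hl.bddAbove_range
    refine ⟨B + 1 + ‖z‖, fun k => ?_⟩
    have h1 : ‖u k - z‖ ^ 2 ≤ B := hB ⟨k, rfl⟩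
    have h2 : ‖u k‖ ≤ ‖u k - z‖ + ‖z‖ := by simpa using norm_add_le (u k - z) z
    nlinarith [sq_nonneg (‖u k - z‖ - 1)]
  -- In the difference of the two squared distances the term ‖u k‖² cancels.
  have hdiff : ∀ a ∈ S, ∀ b ∈ S, ∃ l, Tendsto (fun k => inner ℝ (u k) (a - b)) atTop (𝓝 l) := by
    intro a ha b hb
    obtain ⟨l, hl⟩ := hlim a ha
    obtain ⟨m, hm⟩ := hlim b hb
    refine ⟨_, (((hm.sub hl).add_const (‖a‖ ^ 2 - ‖b‖ ^ 2)).div_const 2).congr fun k => ?_⟩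
    rw [norm_sub_sq_real, norm_sub_sq_real, inner_sub_right]
    ring
  obtain ⟨x, φ, hφ, hx⟩ := exists_weak_limit_subseq hC
  have hxS := hclus x φ hφ.tendsto_atTop hx
  refine ⟨x, hxS, fun h => tendsto_of_subseq_tendsto fun ns hns => ?_⟩
  obtain ⟨x', ms, hms, hx'⟩ := exists_weak_limit_subseq (u := fun k => u (ns k)) fun k => hC _
  have hT := hns.comp hms.tendsto_atTop
  have hxS' := hclus x' _ hT hx'
  obtain ⟨l, hl⟩ := hdiff x hxS x' hxS'
  have e1 := tendsto_nhds_unique (hl.comp hφ.tendsto_atTop) (hx _)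
  have e2 := tendsto_nhds_unique (hl.comp hT) (hx' _)
  -- Both cluster points have the same inner product `l` with x - x', so ‖x - x'‖² = 0.
  have : x = x' := by
    rw [← sub_eq_zero, ← inner_self_eq_zero (𝕜 := ℝ), inner_sub_left, ← e1, ← e2, sub_self]
  exact ⟨ms, by rw [this]; exact hx' h⟩

-- The distance to `z` is a uniform limit, over k, of distances to points of `D`, so it is Cauchy.
-- This lets a countable set of minimizers, hence a single null set, serve all of them.
omit [InnerProductSpace ℝ H] [CompleteSpace H] in
theorem exists_tendsto_norm_sub_sq_of_dense {u : ℕ → H} {S D : Set H} (hSD : S ⊆ closure D)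
    (h : ∀ z ∈ D, ∃ l, Tendsto (fun k => ‖u k - z‖ ^ 2) atTop (𝓝 l)) :
    ∀ z ∈ S, ∃ l, Tendsto (fun k => ‖u k - z‖ ^ 2) atTop (𝓝 l) := by
  intro z hz
  suffices hc : CauchySeq fun k => ‖u k - z‖ by
    obtain ⟨l, hl⟩ := cauchySeq_tendsto_of_complete hc
    exact ⟨_, hl.pow 2⟩
  rw [Metric.cauchySeq_iff]
  intro ε hε
  obtain ⟨a, ha, haz⟩ := Metric.mem_closure_iff.1 (hSD hz) (ε / 3) (by positivity)
  obtain ⟨l, hl⟩ := h a ha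
  have hl' : Tendsto (fun k => ‖u k - a‖) atTop (𝓝 (√l)) :=
    (hl.sqrt).congr fun k => by rw [Real.sqrt_sq (norm_nonneg _)]
  obtain ⟨N, hN⟩ := Metric.cauchySeq_iff.1 hl'.cauchySeq (ε / 3) (by positivity)
  refine ⟨N, fun m hm n hn => ?_⟩
  have h1 := hN m hm n hn
  have hb : ∀ k, |‖u k - z‖ - ‖u k - a‖| < ε / 3 := fun k => by
    refine (abs_norm_sub_norm_le _ _).trans_lt ?_
    rw [sub_sub_sub_cancel_left, ← dist_eq_norm, dist_comm]; exact haz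
  rw [Real.dist_eq] at h1 ⊢
  have h2 := abs_lt.1 (hb m)
  have h3 := abs_lt.1 (hb n)
  have h4 := abs_lt.1 h1
  rw [abs_lt]; constructor <;> linarith

omit [CompleteSpace H] in
/-- A map into a separable Hilbert space is measurable as soon as it is weakly measurable. -/
theorem measurable_of_forall_inner [TopologicalSpace.SeparableSpace H] [MeasurableSpace H]
    [BorelSpace H] {Ω : Type*} [MeasurableSpace Ω] {X : Ω → H}
    (hX : ∀ h, Measurable fun ω => inner ℝ (X ω) h) : Measurable X := by
  classical
  have : SecondCountableTopology H := UniformSpace.secondCountable_of_separable H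
  obtain ⟨D, hDc, hDd⟩ := TopologicalSpace.exists_countable_dense H
  have hball : ∀ a r, MeasurableSet (X ⁻¹' Metric.closedBall a r) := by
    intro a r
    by_cases hr : 0 ≤ r
    swap
    · rw [Metric.closedBall_eq_empty.2 (not_le.1 hr)]; simp
    -- A closed ball is a countable intersection of half-spaces: the inequality extends from `D` by
    -- density, and the test vector X ω - a recovers the norm.
    have : X ⁻¹' Metric.closedBall a r = ⋂ h ∈ D, {ω | inner ℝ (X ω) h - inner ℝ a h ≤ r * ‖h‖} := by
      ext ω
      simp only [Set.mem_preimage, Metric.mem_closedBall, dist_eq_norm, Set.mem_iInter,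
        Set.mem_ofPred_eq, ← inner_sub_left]
      constructor
      · intro h v _
        exact (real_inner_le_norm _ _).trans (by gcongr)
      · intro h
        have hcl : IsClosed {v : H | inner ℝ (X ω - a) v ≤ r * ‖v‖} :=
          isClosed_le (by fun_prop) (by fun_prop)
        have h2 : X ω - a ∈ {v : H | inner ℝ (X ω - a) v ≤ r * ‖v‖} :=
          (hcl.closure_subset_iff.2 (fun v hv => h v hv)) (hDd _)
        rw [Set.mem_ofPred_eq, real_inner_self_eq_norm_sq] at h2
        by_contra hcon
        have := not_le.1 hcon
        nlinarith [norm_nonneg (X ω - a)]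
    rw [this]
    exact MeasurableSet.biInter hDc fun h _ =>
      measurableSet_le ((hX h).sub_const _) measurable_const
  refine measurable_of_isOpen fun U hU => ?_
  have : X ⁻¹' U = ⋃ a ∈ D, ⋃ n : ℕ, if Metric.closedBall a (1 / ((n : ℝ) + 1)) ⊆ U then
      X ⁻¹' Metric.closedBall a (1 / ((n : ℝ) + 1)) else ∅ := by
    ext ω
    simp only [Set.mem_iUnion, Set.mem_preimage]
    constructor
    · intro h
      obtain ⟨ε, hε, hb⟩ := Metric.isOpen_iff.1 hU _ h
      obtain ⟨n, hn⟩ := exists_nat_one_div_lt (half_pos hε)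
      obtain ⟨a, ha, hd⟩ := hDd.exists_dist_lt (X ω) (Nat.one_div_pos_of_nat (n := n) (α := ℝ))
      refine ⟨a, ha, n, ?_⟩
      rw [if_pos]
      · exact hd.le
      · intro b hbm
        refine hb ?_
        rw [Metric.mem_ball, dist_comm]
        have h3 := dist_triangle (X ω) a b
        rw [Metric.mem_closedBall, dist_comm] at hbm
        linarith
    · rintro ⟨a, -, n, h⟩
      split_ifs at h with hsub
      · exact hsub h
      · exact h.elim
  rw [this]
  refine MeasurableSet.biUnion hDc fun a _ => MeasurableSet.iUnion fun n => ?_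
  split_ifs
  · exact hball _ _
  · exact MeasurableSet.empty

/-- A weak almost sure limit of random vectors can be realised as a random vector with values in
a prescribed nonempty set. -/
theorem exists_measurable_weak_limit [TopologicalSpace.SeparableSpace H] [MeasurableSpace H]
    [BorelSpace H] {Ω : Type*} [MeasurableSpace Ω] {P : Measure Ω} {u : ℕ → Ω → H}
    (hu : ∀ k, Measurable (u k)) {S : Set H} (hS : S.Nonempty)
    (h : ∀ᵐ ω ∂P, ∃ x ∈ S, WeaklyConverges (fun k => u k ω) x) :
    ∃ X : Ω → H, Measurable X ∧ (∀ ω, X ω ∈ S) ∧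
      ∀ᵐ ω ∂P, WeaklyConverges (fun k => u k ω) (X ω) := by
  classical
  obtain ⟨z, hz⟩ := hS
  -- The bad set need not be measurable; on its measurable null hull the limit is replaced by `z`.
  set N : Set Ω := toMeasurable P {ω | ¬ ∃ x ∈ S, WeaklyConverges (fun k => u k ω) x} with hN
  have hNm : MeasurableSet N := measurableSet_toMeasurable _ _
  have hN0 : P N = 0 := by rw [hN, measure_toMeasurable]; exact h
  have hex : ∀ ω, ω ∉ N → ∃ x ∈ S, WeaklyConverges (fun k => u k ω) x := fun ω hω =>
    not_not.1 fun hc => hω (subset_toMeasurable _ _ hc)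
  choose! g hgS hg using hex
  refine ⟨fun ω => if ω ∈ N then z else g ω, ?_, fun ω => ?_, ?_⟩
  · refine measurable_of_forall_inner fun v => ?_
    refine measurable_of_tendsto_metrizable (f := fun k ω =>
      if ω ∈ N then inner ℝ z v else inner ℝ (u k ω) v) (fun k => ?_) ?_
    · have := hu k
      exact Measurable.ite hNm measurable_const (by fun_prop)
    · rw [tendsto_pi_nhds]
      intro ω
      by_cases hω : ω ∈ N
      · simp [hω]
      · simpa [hω] using weaklyConverges_iff_forall_inner.1 (hg ω hω) v
  · by_cases hω : ω ∈ N
    · simpa [hω] using hz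
    · simpa [hω] using hgS ω hω
  · have : ∀ᵐ ω ∂P, ω ∉ N := measure_eq_zero_iff_ae_notMem.1 hN0
    filter_upwards [this] with ω hω
    simpa [hω] using hg ω hω

end Weak

/-! ### Telescoping and summability of random series. -/

section Sequences

theorem summable_and_bdd_of_add_le {a b c : ℕ → ℝ} (ha : ∀ k, 0 ≤ a k) (hb : ∀ k, 0 ≤ b k)
    (hc : ∀ k, 0 ≤ c k) (hcs : Summable c) (h : ∀ k, a (k + 1) + b k ≤ a k + c k) :
    Summable b ∧ ∃ B, ∀ k, a k ≤ B := by
  have key : ∀ n, a n + ∑ k ∈ Finset.range n, b k ≤ a 0 + ∑ k ∈ Finset.range n, c k := by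
    intro n
    induction n with
    | zero => simp
    | succ n ih =>
      rw [Finset.sum_range_succ, Finset.sum_range_succ]
      linarith [h n]
  have hC : ∀ n, ∑ k ∈ Finset.range n, c k ≤ ∑' k, c k := fun n =>
    hcs.sum_le_tsum _ fun k _ => hc k
  refine ⟨summable_of_sum_range_le (c := a 0 + ∑' k, c k) hb fun n => ?_,
    a 0 + ∑' k, c k, fun n => ?_⟩
  · linarith [key n, hC n, ha n]
  · linarith [key n, hC n, Finset.sum_nonneg fun k (_ : k ∈ Finset.range n) => hb k]

theorem ae_summable_of_summable_integral {Ω : Type*} {mΩ : MeasurableSpace Ω} {P : Measure Ω}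
    {b : ℕ → Ω → ℝ} (hb : ∀ k ω, 0 ≤ b k ω) (hint : ∀ k, Integrable (b k) P)
    (hs : Summable fun k => ∫ ω, b k ω ∂P) : ∀ᵐ ω ∂P, Summable fun k => b k ω := by
  have h1 : ∫⁻ ω, ∑' k, ENNReal.ofReal (b k ω) ∂P ≠ ∞ := by
    rw [lintegral_tsum fun k => (hint k).aemeasurable.ennreal_ofReal]
    simp_rw [← fun k => ofReal_integral_eq_lintegral_ofReal (hint k) (ae_of_all _ (hb k))]
    exact hs.tsum_ofReal_ne_top
  have h2 := ae_lt_top' (AEMeasurable.tsum fun k =>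
    (hint k).aemeasurable.ennreal_ofReal) h1
  filter_upwards [h2] with ω hω
  have := ENNReal.summable_toReal hω.ne
  exact this.congr fun k => (ENNReal.toReal_ofReal (hb k ω))

end Sequences

/-! ### Deterministic one-step estimates. -/

section Path

variable {H : Type*} [NormedAddCommGroup H] [InnerProductSpace ℝ H] [CompleteSpace H]

/-- Inertial form of the Ravine method: `x k` is the gradient-step iterate, `d k` the momentum
`x k - x (k - 1)`, and the gradient is evaluated at `x k + α • d k`. -/
structure IsInertialPath (f : H → ℝ) (s : ℕ → ℝ) (α : ℝ) (e x d : ℕ → H) : Prop where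
  d_zero : d 0 = 0
  d_succ : ∀ k, d (k + 1) = α • d k - s k • (gradient f (x k + α • d k) + e k)
  x_succ : ∀ k, x (k + 1) = x k + d (k + 1)

omit [InnerProductSpace ℝ H] [CompleteSpace H] in
theorem norm_sq_add_three_le (a b c : H) :
    ‖a - b - c‖ ^ 2 ≤ 3 * (‖a‖ ^ 2 + ‖b‖ ^ 2 + ‖c‖ ^ 2) := by
  have h1 : ‖a - b - c‖ ≤ ‖a‖ + ‖b‖ + ‖c‖ :=
    (norm_sub_le _ _).trans (by gcongr; exact norm_sub_le _ _)
  nlinarith [norm_nonneg (a - b - c), sq_nonneg (‖a‖ - ‖b‖), sq_nonneg (‖a‖ - ‖c‖),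
    sq_nonneg (‖b‖ - ‖c‖), norm_nonneg a, norm_nonneg b, norm_nonneg c]

omit [CompleteSpace H] in
theorem norm_smul_sq_le_of_abs_le_one {α : ℝ} (hα₀ : 0 ≤ α) (hα₁ : α ≤ 1) (d : H) :
    ‖α • d‖ ^ 2 ≤ ‖d‖ ^ 2 := by
  rw [norm_smul, mul_pow, Real.norm_of_nonneg hα₀]
  exact mul_le_of_le_one_left (sq_nonneg _) (pow_le_one₀ hα₀ hα₁)

/-- One step of the mechanical energy estimate. -/
theorem energy_step {f : H → ℝ} {L : ℝ≥0} (hconv : ConvexOn ℝ Set.univ f)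
    (hdiff : Differentiable ℝ f) (hlip : LipschitzWith L (gradient f)) {s α : ℝ} (hs : 0 ≤ s)
    (hsL : s * L ≤ 1) {x d d' e : H}
    (hd' : d' = α • d - s • (gradient f (x + α • d) + e)) :
    s * f (x + d') + 1 / 2 * ‖d'‖ ^ 2 ≤ s * f x + 1 / 2 * α ^ 2 * ‖d‖ ^ 2
      - inner ℝ (α • d - s • gradient f (x + α • d)) (s • e) + ‖s • e‖ ^ 2 := by
  set y := x + α • d with hy
  set g := gradient f y with hg
  have h1 := hlip.descent hdiff y (x + d')
  have h2 := hconv.add_inner_gradient_le hdiff y x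
  rw [← hg] at h1 h2
  have e1 : x + d' - y = d' - α • d := by rw [hy]; abel
  have e2 : x - y = -(α • d) := by rw [hy]; abel
  rw [e1] at h1
  rw [e2] at h2
  -- Descent from `y` to x + d' and convexity from `y` to `x` are added; the terms ⟨g, α d⟩ cancel.
  have h3 : f (x + d') ≤ f x + inner ℝ g d' + L / 2 * ‖d' - α • d‖ ^ 2 := by
    rw [inner_sub_right] at h1
    rw [inner_neg_right] at h2
    linarith
  have h4 : s * f (x + d') ≤ s * f x + inner ℝ (s • g) d' + 1 / 2 * ‖d' - α • d‖ ^ 2 := by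
    rw [real_inner_smul_left]
    have := mul_le_mul_of_nonneg_left h3 hs
    nlinarith [sq_nonneg ‖d' - α • d‖, mul_le_mul_of_nonneg_right hsL (sq_nonneg ‖d' - α • d‖)]
  have hsg : s • g = α • d - d' - s • e := by rw [hd', smul_add]; abel
  have hd2 : α • d - s • g = d' + s • e := by rw [hsg]; abel
  rw [hd2]
  rw [hsg] at h4
  have e3 : ‖α • d‖ ^ 2 = α ^ 2 * ‖d‖ ^ 2 := by
    rw [norm_smul, mul_pow, Real.norm_eq_abs, sq_abs]
  rw [norm_sub_sq_real, inner_sub_left, inner_sub_left, e3, real_inner_self_eq_norm_sq,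
    real_inner_comm] at h4
  rw [inner_add_left, real_inner_self_eq_norm_sq]
  have := real_inner_comm d' (s • e)
  linarith

-- The recursion expresses the scaled gradient through consecutive momenta and the error, so no
-- cocoercivity is needed to control it.
omit [CompleteSpace H] in
theorem norm_smul_gradient_sq_le {s α : ℝ} (hα₀ : 0 ≤ α) (hα₁ : α ≤ 1) {d d' g e : H}
    (hd' : d' = α • d - s • (g + e)) :
    ‖s • g‖ ^ 2 ≤ 3 * (‖d‖ ^ 2 + ‖d'‖ ^ 2 + ‖s • e‖ ^ 2) := by
  have hsg : s • g = α • d - d' - s • e := by rw [hd', smul_add]; abel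
  rw [hsg]
  have := norm_sq_add_three_le (α • d) d' (s • e)
  have := norm_smul_sq_le_of_abs_le_one hα₀ hα₁ d
  linarith

/-- One step of the anchored estimate, for the auxiliary point `x + (α / (1 - α)) • d`. -/
theorem anchor_step {f : H → ℝ} (hconv : ConvexOn ℝ Set.univ f) (hdiff : Differentiable ℝ f)
    {s α : ℝ} (hs : 0 ≤ s) (hα₀ : 0 ≤ α) (hα₁ : α < 1) {x d d' e : H}
    (hd' : d' = α • d - s • (gradient f (x + α • d) + e)) (z : H) :
    ‖x + d' + (α / (1 - α)) • d' - z‖ ^ 2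
        + 2 / (1 - α) * (s * (f (x + α • d) - f z)) ≤
      ‖x + (α / (1 - α)) • d - z‖ ^ 2
        - 2 / (1 - α) * inner ℝ (x + (α / (1 - α)) • d - z) (s • e)
        + 6 / (1 - α) ^ 2 * (‖d‖ ^ 2 + ‖d'‖ ^ 2 + ‖s • e‖ ^ 2) := by
  have hβ : 0 < 1 - α := sub_pos.2 hα₁
  have hβ' := hβ.ne'
  set β := 1 - α with hβdef
  have hα : α = 1 - β := by rw [hβdef]; ring
  set y := x + α • d with hy
  set g := gradient f y with hg
  set p := x + (α / β) • d with hp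
  have hstep : s • g + s • e = α • d - d' := by rw [hd', smul_add]; abel
  -- The weight α/(1-α) is the one for which the momentum drops out of the update of `p`.
  have e1 : x + d' + (α / β) • d' - z = (p - z) - (1 / β) • (s • g + s • e) := by
    rw [hstep, hp]
    have c1 : α / β = 1 / β - 1 := by rw [hα]; field_simp
    have c2 : α / β = 1 / β * α := by ring
    rw [smul_sub, smul_smul, ← c2]
    have : (1 / β) • d' = d' + (α / β) • d' := by rw [c1, sub_smul, one_smul]; abel
    rw [this]; abel
  have e2 : p - z = (y - z) + (α ^ 2 / β) • d := by
    rw [hp, hy]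
    have : α / β = α + α ^ 2 / β := by rw [hα]; field_simp; ring
    rw [this, add_smul]; abel
  have h1 := hconv.add_inner_gradient_le hdiff y z
  rw [← hg, ← neg_sub y z, inner_neg_right] at h1
  have h1' : s * (f y - f z) ≤ inner ℝ (y - z) (s • g) := by
    rw [real_inner_smul_right, real_inner_comm]
    exact mul_le_mul_of_nonneg_left (by linarith) hs
  have h2 : -inner ℝ d (s • g) ≤ 1 / 2 * (‖d‖ ^ 2 + ‖s • g‖ ^ 2) := by
    have := norm_add_sq_real d (s • g)
    nlinarith [sq_nonneg ‖d + s • g‖]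
  have h3 := norm_smul_gradient_sq_le hα₀ hα₁.le hd'
  have h4 : ‖s • g + s • e‖ ^ 2 ≤ 2 * (‖d‖ ^ 2 + ‖d'‖ ^ 2) := by
    rw [hstep]
    have h5 := norm_sub_le (α • d) d'
    have h6 := norm_smul_sq_le_of_abs_le_one hα₀ hα₁.le d
    nlinarith [norm_nonneg (α • d - d'), norm_nonneg (α • d), norm_nonneg d',
      sq_nonneg (‖α • d‖ - ‖d'‖)]
  rw [e1, norm_sub_sq_real, norm_smul, mul_pow, Real.norm_eq_abs, sq_abs, inner_smul_right,
    inner_add_right]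
  have e3 : inner ℝ (p - z) (s • g) = inner ℝ (y - z) (s • g) + α ^ 2 / β * inner ℝ d (s • g) := by
    rw [e2, inner_add_left, inner_smul_left]; rfl
  rw [e3]
  have hα2 : α ^ 2 ≤ 1 := pow_le_one₀ hα₀ hα₁.le
  have h7 : -(α ^ 2 * inner ℝ d (s • g)) ≤
      1 / 2 * (‖d‖ ^ 2 + 3 * (‖d‖ ^ 2 + ‖d'‖ ^ 2 + ‖s • e‖ ^ 2)) := by
    have a1 := mul_le_mul_of_nonneg_left h2 (sq_nonneg α)
    have a2 : α ^ 2 * (1 / 2 * (‖d‖ ^ 2 + ‖s • g‖ ^ 2)) ≤ 1 / 2 * (‖d‖ ^ 2 + ‖s • g‖ ^ 2) :=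
      mul_le_of_le_one_left (by positivity) hα2
    linarith
  -- `h7` and `h4` give coefficients 4 + 2, 3 + 2 and 3, all at most 6.
  have h8 : 2 * (-(α ^ 2 * inner ℝ d (s • g))) + ‖s • g + s • e‖ ^ 2 ≤
      6 * (‖d‖ ^ 2 + ‖d'‖ ^ 2 + ‖s • e‖ ^ 2) := by
    linarith [sq_nonneg ‖s • e‖, sq_nonneg ‖d'‖]
  have h9 := mul_le_mul_of_nonneg_left h8 (by positivity : 0 ≤ 1 / β ^ 2)
  have h10 := mul_le_mul_of_nonneg_left h1' (by positivity : 0 ≤ 2 / β)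
  have e4 : 1 / β ^ 2 * (2 * (-(α ^ 2 * inner ℝ d (s • g))) + ‖s • g + s • e‖ ^ 2) =
      -(2 / β * (α ^ 2 / β * inner ℝ d (s • g))) + (1 / β) ^ 2 * ‖s • g + s • e‖ ^ 2 := by
    field_simp
  rw [e4] at h9
  have e5 : 1 / β ^ 2 * (6 * (‖d‖ ^ 2 + ‖d'‖ ^ 2 + ‖s • e‖ ^ 2)) =
    6 / β ^ 2 * (‖d‖ ^ 2 + ‖d'‖ ^ 2 + ‖s • e‖ ^ 2) := by ring
  rw [e5] at h9
  have e6 : 2 * (1 / β * (inner ℝ (y - z) (s • g) + α ^ 2 / β * inner ℝ d (s • g)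
      + inner ℝ (p - z) (s • e))) = 2 / β * inner ℝ (y - z) (s • g)
      + 2 / β * (α ^ 2 / β * inner ℝ d (s • g)) + 2 / β * inner ℝ (p - z) (s • e) := by ring
  rw [e6]
  linarith

end Path

/-! ### Stochastic estimates under square-integrable errors. -/

section SquareIntegrable

variable {H : Type*} [NormedAddCommGroup H] [InnerProductSpace ℝ H] [CompleteSpace H]
  {Ω : Type*} {mΩ : MeasurableSpace Ω} {P : Measure Ω}

omit [InnerProductSpace ℝ H] [CompleteSpace H] in
theorem MeasureTheory.MemLp.integrable_norm_sq {u : Ω → H} (hu : MemLp u 2 P) :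
    Integrable (fun ω => ‖u ω‖ ^ 2) P := by
  simpa using hu.integrable_norm_pow two_ne_zero

omit [CompleteSpace H] in
theorem MeasureTheory.MemLp.integrable_inner_of_two {u v : Ω → H} (hu : MemLp u 2 P)
    (hv : MemLp v 2 P) : Integrable (fun ω => inner ℝ (u ω) (v ω)) P := by
  refine Integrable.mono' (hu.integrable_norm_sq.add hv.integrable_norm_sq)
    (hu.1.inner hv.1) (ae_of_all _ fun ω => ?_)
  have := norm_inner_le_norm (𝕜 := ℝ) (u ω) (v ω)
  simp only [Pi.add_apply]
  nlinarith [sq_nonneg (‖u ω‖ - ‖v ω‖), sq_nonneg (‖u ω‖), sq_nonneg (‖v ω‖)]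

theorem condExp_inner_eq_zero [IsFiniteMeasure P] {m : MeasurableSpace Ω} {u v : Ω → H}
    (hum : StronglyMeasurable[m] u) (hu : MemLp u 2 P) (hv : MemLp v 2 P)
    (hv0 : P[v | m] =ᵐ[P] 0) : P[fun ω => inner ℝ (u ω) (v ω) | m] =ᵐ[P] 0 := by
  have h := condExp_bilin_of_stronglyMeasurable_left (innerSL ℝ) (μ := P) hum
    (hu.integrable_inner_of_two hv) (hv.integrable one_le_two)
  filter_upwards [h, hv0] with ω h1 h2
  refine h1.trans ?_
  rw [h2]; simp

theorem integral_inner_eq_zero [IsFiniteMeasure P] {m : MeasurableSpace Ω} (hm : m ≤ mΩ)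
    {u v : Ω → H} (hum : StronglyMeasurable[m] u) (hu : MemLp u 2 P) (hv : MemLp v 2 P)
    (hv0 : P[v | m] =ᵐ[P] 0) : ∫ ω, inner ℝ (u ω) (v ω) ∂P = 0 := by
  rw [← integral_condExp hm, integral_congr_ae (condExp_inner_eq_zero hum hu hv hv0)]
  simp

theorem integral_step {A B C D I : Ω → ℝ} (hA : Integrable A P) (hB : Integrable B P)
    (hC : Integrable C P) (hD : Integrable D P) (hI : Integrable I P) (hI0 : ∫ ω, I ω ∂P = 0)
    (c c' : ℝ) (h : ∀ ω, A ω + c * B ω ≤ C ω - c' * I ω + D ω) :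
    ∫ ω, A ω ∂P + c * ∫ ω, B ω ∂P ≤ ∫ ω, C ω ∂P + ∫ ω, D ω ∂P := by
  have := integral_mono (hA.add (hB.const_mul c)) ((hC.sub (hI.const_mul c')).add hD) h
  rw [integral_add' hA (hB.const_mul c), integral_add' (hC.sub (hI.const_mul c')) hD,
    integral_sub' hC (hI.const_mul c'), integral_const_mul, integral_const_mul, hI0] at this
  linarith

variable {f : H → ℝ} {L : ℝ≥0} {s : ℕ → ℝ} {α : ℝ} {ℱ : Filtration ℕ mΩ} {e x d : ℕ → Ω → H}

theorem IsInertialPath.stronglyMeasurable (hlip : LipschitzWith L (gradient f))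
    (hpath : ∀ ω, IsInertialPath f s α (e · ω) (x · ω) (d · ω))
    (hx₀ : StronglyMeasurable[ℱ 0] (x 0)) (he : ∀ k, StronglyMeasurable[ℱ (k + 1)] (e k)) (k : ℕ) :
    StronglyMeasurable[ℱ k] (x k) ∧ StronglyMeasurable[ℱ k] (d k) := by
  induction k with
  | zero =>
    refine ⟨hx₀, ?_⟩
    have : d 0 = fun _ => 0 := funext fun ω => (hpath ω).d_zero
    rw [this]
    exact stronglyMeasurable_const
  | succ k ih =>
    have hx := ih.1.mono (ℱ.mono k.le_succ)
    have hd := ih.2.mono (ℱ.mono k.le_succ)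
    have hd' : StronglyMeasurable[ℱ (k + 1)] (d (k + 1)) := by
      rw [show d (k + 1) = fun ω => α • d k ω - s k • (gradient f (x k ω + α • d k ω) + e k ω) from
        funext fun ω => (hpath ω).d_succ k]
      exact (hd.const_smul α).sub (((hlip.continuous.comp_stronglyMeasurable
        (hx.add (hd.const_smul α))).add (he k)).const_smul (s k))
    refine ⟨?_, hd'⟩
    rw [show x (k + 1) = fun ω => x k ω + d (k + 1) ω from funext fun ω => (hpath ω).x_succ k]
    exact hx.add hd'

/-- Subtracting the gradient at 0 gives a Lipschitz map fixing 0, which preserves L²; the constant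
is in L² because `P` is finite. -/
theorem memLp_gradient_comp [IsFiniteMeasure P] (hlip : LipschitzWith L (gradient f)) {u : Ω → H}
    (hu : MemLp u 2 P) : MemLp (fun ω => gradient f (u ω)) 2 P := by
  have h : LipschitzWith L fun v => gradient f v - gradient f 0 :=
    hlip.sub (LipschitzWith.const _) |>.weaken (by simp)
  have := (h.comp_memLp (by simp) hu).add (memLp_const (gradient f 0))
  refine this.congr_norm ?_ (ae_of_all _ fun ω => by simp)
  exact hlip.continuous.comp_aestronglyMeasurable hu.1

theorem IsInertialPath.memLp [IsFiniteMeasure P] (hlip : LipschitzWith L (gradient f))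
    (hpath : ∀ ω, IsInertialPath f s α (e · ω) (x · ω) (d · ω))
    (hx₀ : MemLp (x 0) 2 P) (he : ∀ k, MemLp (e k) 2 P) (k : ℕ) :
    MemLp (x k) 2 P ∧ MemLp (d k) 2 P := by
  induction k with
  | zero =>
    refine ⟨hx₀, ?_⟩
    have : d 0 = fun _ => 0 := funext fun ω => (hpath ω).d_zero
    rw [this]
    exact memLp_const 0
  | succ k ih =>
    have hd' : MemLp (d (k + 1)) 2 P := by
      rw [show d (k + 1) = fun ω => α • d k ω - s k • (gradient f (x k ω + α • d k ω) + e k ω) from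
        funext fun ω => (hpath ω).d_succ k]
      exact (ih.2.const_smul α).sub
        (((memLp_gradient_comp hlip (ih.1.add (ih.2.const_smul α))).add (he k)).const_smul (s k))
    refine ⟨?_, hd'⟩
    rw [show x (k + 1) = fun ω => x k ω + d (k + 1) ω from funext fun ω => (hpath ω).x_succ k]
    exact ih.1.add hd'

theorem integrable_sub_min [IsFiniteMeasure P] (hdiff : Differentiable ℝ f)
    (hlip : LipschitzWith L (gradient f)) {z : H} (hz : z ∈ argminSet f) {u : Ω → H}
    (hu : MemLp u 2 P) : Integrable (fun ω => f (u ω) - f z) P := by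
  have h1 : MemLp (fun ω => u ω - z) 2 P := hu.sub (memLp_const z)
  refine Integrable.mono' (h1.integrable_norm_sq.const_mul ((L : ℝ) / 2))
    ((hdiff.continuous.comp_aestronglyMeasurable hu.1).sub aestronglyMeasurable_const) (ae_of_all _ fun ω => ?_)
  have h2 := hlip.descent hdiff z (u ω)
  rw [gradient_eq_zero_of_mem_argminSet hz, inner_zero_left] at h2
  rw [Real.norm_of_nonneg (sub_nonneg.2 (hz _))]
  linarith

/-- The expected energy is telescoped. The noise is paired with α d_k - s_k g_k, which is known at
time k, so its expectation vanishes. -/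
theorem IsInertialPath.summable_integral_norm_sq [IsFiniteMeasure P]
    (hconv : ConvexOn ℝ Set.univ f) (hdiff : Differentiable ℝ f)
    (hlip : LipschitzWith L (gradient f)) {z : H} (hz : z ∈ argminSet f)
    (hα₀ : 0 ≤ α) (hα₁ : α < 1) (hs_pos : ∀ k, 0 < s k) (hs_le : ∀ k, s k * L ≤ 1)
    (hs_anti : Antitone s)
    (hpath : ∀ ω, IsInertialPath f s α (e · ω) (x · ω) (d · ω))
    (hx₀ : StronglyMeasurable[ℱ 0] (x 0)) (hx₀_sq : MemLp (x 0) 2 P)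
    (he : ∀ k, StronglyMeasurable[ℱ (k + 1)] (e k)) (he_sq : ∀ k, MemLp (e k) 2 P)
    (he_mean : ∀ k, P[e k | ℱ k] =ᵐ[P] 0)
    (he_sum : Summable fun k => ∫ ω, ‖s k • e k ω‖ ^ 2 ∂P) :
    Summable fun k => ∫ ω, ‖d k ω‖ ^ 2 ∂P := by
  have hm := IsInertialPath.stronglyMeasurable hlip hpath hx₀ he
  have hL := IsInertialPath.memLp hlip hpath hx₀_sq he_sq
  have hα2 : α ^ 2 < 1 := pow_lt_one₀ hα₀ hα₁ two_ne_zero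
  have hdI : ∀ k, Integrable (fun ω => ‖d k ω‖ ^ 2) P := fun k => (hL k).2.integrable_norm_sq
  have hfI : ∀ k, Integrable (fun ω => f (x k ω) - f z) P := fun k =>
    integrable_sub_min hdiff hlip hz (hL k).1
  have heI : ∀ k, MemLp (fun ω => s k • e k ω) 2 P := fun k => (he_sq k).const_smul (s k)
  have hcond : ∀ k, P[fun ω => s k • e k ω | ℱ k] =ᵐ[P] 0 := fun k => by
    filter_upwards [condExp_smul (μ := P) (s k) (e k) (ℱ k), he_mean k] with ω h1 h2
    exact h1.trans (by simp [h2])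
  have hvm : ∀ k, StronglyMeasurable[ℱ k]
      fun ω => α • d k ω - s k • gradient f (x k ω + α • d k ω) := fun k =>
    ((hm k).2.const_smul α).sub ((hlip.continuous.comp_stronglyMeasurable
        ((hm k).1.add ((hm k).2.const_smul α))).const_smul (s k))
  have hvL : ∀ k, MemLp (fun ω => α • d k ω - s k • gradient f (x k ω + α • d k ω)) 2 P := fun k =>
    ((hL k).2.const_smul α).sub
      ((memLp_gradient_comp hlip ((hL k).1.add ((hL k).2.const_smul α))).const_smul (s k))
  have hstep : ∀ k,
      (∫ ω, s (k + 1) * (f (x (k + 1) ω) - f z) + 1 / 2 * ‖d (k + 1) ω‖ ^ 2 ∂P)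
        + (1 - α ^ 2) / 2 * ∫ ω, ‖d k ω‖ ^ 2 ∂P ≤
      (∫ ω, s k * (f (x k ω) - f z) + 1 / 2 * ‖d k ω‖ ^ 2 ∂P)
        + ∫ ω, ‖s k • e k ω‖ ^ 2 ∂P := by
    intro k
    have h0 := integral_inner_eq_zero (ℱ.le k) (hvm k) (hvL k) (heI k) (hcond k)
    have hI := (hvL k).integrable_inner_of_two (heI k)
    have hA : ∀ j, Integrable (fun ω => s j * (f (x j ω) - f z) + 1 / 2 * ‖d j ω‖ ^ 2) P :=
      fun j => ((hfI j).const_mul _).add ((hdI j).const_mul _)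
    refine integral_step (hA _) (hdI k) (hA _) (heI k).integrable_norm_sq hI h0
      ((1 - α ^ 2) / 2) 1 fun ω => ?_
    have h1 := energy_step hconv hdiff hlip (hs_pos k).le (hs_le k) ((hpath ω).d_succ k)
    -- Monotonicity of the steps lets the weight in the energy pass from k to k + 1.
    have h2 : s (k + 1) * (f (x (k + 1) ω) - f z) ≤ s k * (f (x (k + 1) ω) - f z) :=
      mul_le_mul_of_nonneg_right (hs_anti k.le_succ) (sub_nonneg.2 (hz _))
    rw [← (hpath ω).x_succ k] at h1
    linarith
  have h := (summable_and_bdd_of_add_le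
    (a := fun k => ∫ ω, s k * (f (x k ω) - f z) + 1 / 2 * ‖d k ω‖ ^ 2 ∂P)
    (b := fun k => (1 - α ^ 2) / 2 * ∫ ω, ‖d k ω‖ ^ 2 ∂P)
    (c := fun k => ∫ ω, ‖s k • e k ω‖ ^ 2 ∂P) (fun k => integral_nonneg fun ω => ?_)
    (fun k => mul_nonneg (by linarith) (integral_nonneg fun ω => by positivity))
    (fun k => integral_nonneg fun ω => by positivity) he_sum hstep).1
  swap
  · have := mul_nonneg (hs_pos k).le (sub_nonneg.2 (hz (x k ω)))
    simp only [Pi.zero_apply]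
    positivity
  exact (summable_mul_left_iff (by linarith : (1 - α ^ 2) / 2 ≠ 0)).1 h

theorem IsInertialPath.ae_anchor [IsFiniteMeasure P]
    (hconv : ConvexOn ℝ Set.univ f) (hdiff : Differentiable ℝ f)
    (hlip : LipschitzWith L (gradient f)) {z : H} (hz : z ∈ argminSet f)
    (hα₀ : 0 ≤ α) (hα₁ : α < 1) (hs_pos : ∀ k, 0 < s k)
    (hpath : ∀ ω, IsInertialPath f s α (e · ω) (x · ω) (d · ω))
    (hx₀ : StronglyMeasurable[ℱ 0] (x 0)) (hx₀_sq : MemLp (x 0) 2 P)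
    (he : ∀ k, StronglyMeasurable[ℱ (k + 1)] (e k)) (he_sq : ∀ k, MemLp (e k) 2 P)
    (he_mean : ∀ k, P[e k | ℱ k] =ᵐ[P] 0)
    (he_sum : Summable fun k => ∫ ω, ‖s k • e k ω‖ ^ 2 ∂P)
    (hd_sum : Summable fun k => ∫ ω, ‖d k ω‖ ^ 2 ∂P) :
    (∀ᵐ ω ∂P, Summable fun k => s k * (f (x k ω + α • d k ω) - f z)) ∧
    ∀ᵐ ω ∂P, ∃ l, Tendsto (fun k => ‖x k ω + (α / (1 - α)) • d k ω - z‖ ^ 2) atTop (𝓝 l) := by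
  have hβ : 0 < 1 - α := sub_pos.2 hα₁
  have hm := IsInertialPath.stronglyMeasurable hlip hpath hx₀ he
  have hL := IsInertialPath.memLp hlip hpath hx₀_sq he_sq
  have hdI : ∀ k, Integrable (fun ω => ‖d k ω‖ ^ 2) P := fun k => (hL k).2.integrable_norm_sq
  have hfI : ∀ k, Integrable (fun ω => s k * (f (x k ω + α • d k ω) - f z)) P := fun k =>
    (integrable_sub_min hdiff hlip hz ((hL k).1.add ((hL k).2.const_smul α))).const_mul _
  have heL : ∀ k, MemLp (fun ω => s k • e k ω) 2 P := fun k => (he_sq k).const_smul (s k)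
  have hcond : ∀ k, P[fun ω => s k • e k ω | ℱ k] =ᵐ[P] 0 := fun k => by
    filter_upwards [condExp_smul (μ := P) (s k) (e k) (ℱ k), he_mean k] with ω h1 h2
    exact h1.trans (by simp [h2])
  set p : ℕ → Ω → H := fun k ω => x k ω + (α / (1 - α)) • d k ω - z with hp
  have hpm : ∀ k, StronglyMeasurable[ℱ k] (p k) := fun k =>
    ((hm k).1.add ((hm k).2.const_smul _)).sub stronglyMeasurable_const
  have hpL : ∀ k, MemLp (p k) 2 P := fun k =>
    ((hL k).1.add ((hL k).2.const_smul _)).sub (memLp_const z)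
  have hpI : ∀ k, Integrable (fun ω => ‖p k ω‖ ^ 2) P := fun k => (hpL k).integrable_norm_sq
  set R : ℕ → Ω → ℝ := fun k ω =>
    6 / (1 - α) ^ 2 * (‖d k ω‖ ^ 2 + ‖d (k + 1) ω‖ ^ 2 + ‖s k • e k ω‖ ^ 2) with hR
  have hR0 : ∀ k ω, 0 ≤ R k ω := fun k ω => by positivity
  have hRI : ∀ k, Integrable (R k) P := fun k =>
    (((hdI k).add (hdI (k + 1))).add (heL k).integrable_norm_sq).const_mul _
  have hRs : Summable fun k => ∫ ω, R k ω ∂P := by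
    refine (((hd_sum.add ((summable_nat_add_iff 1).2 hd_sum)).add he_sum).mul_left
      (6 / (1 - α) ^ 2)).congr fun k => ?_
    have h1 := integral_add' ((hdI k).add (hdI (k + 1))) (heL k).integrable_norm_sq
    rw [integral_add' (hdI k) (hdI (k + 1))] at h1
    rw [hR, integral_const_mul, ← h1]
    rfl
  have hpt : ∀ k ω, ‖p (k + 1) ω‖ ^ 2 + 2 / (1 - α) * (s k * (f (x k ω + α • d k ω) - f z)) ≤
      ‖p k ω‖ ^ 2 - 2 / (1 - α) * inner ℝ (p k ω) (s k • e k ω) + R k ω := by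
    intro k ω
    have := anchor_step hconv hdiff (hs_pos k).le hα₀ hα₁ ((hpath ω).d_succ k) z
    rw [← (hpath ω).x_succ k] at this
    exact this
  have hf0 : ∀ k ω, 0 ≤ s k * (f (x k ω + α • d k ω) - f z) := fun k ω =>
    mul_nonneg (hs_pos k).le (sub_nonneg.2 (hz _))
  have hI : ∀ k, Integrable (fun ω => inner ℝ (p k ω) (s k • e k ω)) P := fun k =>
    (hpL k).integrable_inner_of_two (heL k)
  have hstep : ∀ k, ∫ ω, ‖p (k + 1) ω‖ ^ 2 ∂P
      + 2 / (1 - α) * ∫ ω, s k * (f (x k ω + α • d k ω) - f z) ∂P ≤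
      ∫ ω, ‖p k ω‖ ^ 2 ∂P + ∫ ω, R k ω ∂P := fun k =>
    integral_step (hpI _) (hfI k) (hpI k) (hRI k) (hI k)
      (integral_inner_eq_zero (ℱ.le k) (hpm k) (hpL k) (heL k) (hcond k)) _ _ (hpt k)
  obtain ⟨hs1, B, hB⟩ := summable_and_bdd_of_add_le
    (a := fun k => ∫ ω, ‖p k ω‖ ^ 2 ∂P)
    (b := fun k => 2 / (1 - α) * ∫ ω, s k * (f (x k ω + α • d k ω) - f z) ∂P)
    (c := fun k => ∫ ω, R k ω ∂P) (fun k => integral_nonneg fun ω => by positivity)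
    (fun k => mul_nonneg (by positivity) (integral_nonneg (hf0 k)))
    (fun k => integral_nonneg (hR0 k)) hRs hstep
  refine ⟨ae_summable_of_summable_integral hf0 hfI
    ((summable_mul_left_iff (by positivity : 2 / (1 - α) ≠ 0)).1 hs1), ?_⟩
  -- `R k` is only ℱ (k + 1)-measurable, but the sum over k < n is ℱ n-measurable, so subtracting it
  -- yields an adapted supermartingale.
  set U : ℕ → Ω → ℝ := fun n ω => ‖p n ω‖ ^ 2 - ∑ k ∈ Finset.range n, R k ω with hU
  have hUI : ∀ n, Integrable (U n) P := fun n =>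
    (hpI n).sub (integrable_finsetSum _ fun k _ => hRI k)
  have hRm : ∀ k, StronglyMeasurable[ℱ (k + 1)] (R k) := fun k => by
    have h1 := ((hm k).2.mono (ℱ.mono k.le_succ)).norm.pow 2
    have h2 := (hm (k + 1)).2.norm.pow 2
    have h3 := ((he k).const_smul (s k)).norm.pow 2
    exact ((h1.add h2).add h3).const_mul _
  have hUm : StronglyAdapted ℱ U := fun n =>
    ((hpm n).norm.pow 2).sub (Finset.stronglyMeasurable_fun_sum _ fun k hk =>
      (hRm k).mono (ℱ.mono (Finset.mem_range.1 hk)))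
  have hsuper : Supermartingale U ℱ P := by
    refine supermartingale_of_condExp_sub_nonneg_nat hUm hUI fun n => ?_
    have h1 : P[fun ω => 2 / (1 - α) * inner ℝ (p n ω) (s n • e n ω) | ℱ n] =ᵐ[P] 0 := by
      filter_upwards [condExp_smul (μ := P) (2 / (1 - α))
        (fun ω => inner ℝ (p n ω) (s n • e n ω)) (ℱ n),
        condExp_inner_eq_zero (hpm n) (hpL n) (heL n) (hcond n)] with ω h1 h2
      exact h1.trans (by simp [h2])
    refine h1.symm.le.trans (condExp_mono ((hI n).const_mul _) ((hUI n).sub (hUI (n + 1)))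
      (ae_of_all _ fun ω => ?_))
    simp only [hU, Pi.sub_apply, Finset.sum_range_succ]
    have := mul_nonneg (by positivity : 0 ≤ 2 / (1 - α)) (hf0 n ω)
    linarith [hpt n ω]
  -- L¹-boundedness of the submartingale -U yields almost sure convergence; adding back the
  -- convergent series of `R` gives the limit of ‖p n‖².
  have hbdd : ∀ n, eLpNorm ((-U) n) 1 P ≤ ((B + ∑' k, ∫ ω, R k ω ∂P).toNNReal : ℝ≥0∞) := by
    intro n
    have hneg : Integrable ((-U) n) P := (hUI n).neg
    rw [eLpNorm_one_eq_lintegral_enorm, ← ofReal_integral_norm_eq_lintegral_enorm hneg]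
    refine ENNReal.ofReal_le_ofReal ?_
    have h1 : ∫ ω, ‖(-U) n ω‖ ∂P ≤ ∫ ω, ‖p n ω‖ ^ 2 + ∑ k ∈ Finset.range n, R k ω ∂P := by
      refine integral_mono (hUI n).neg.norm
        ((hpI n).add (integrable_finsetSum _ fun k _ => hRI k)) fun ω => ?_
      have h2 := Finset.sum_nonneg fun k (_ : k ∈ Finset.range n) => hR0 k ω
      simp only [Pi.neg_apply, norm_neg, hU, Real.norm_eq_abs]
      rw [abs_le]
      constructor <;> linarith [sq_nonneg ‖p n ω‖]
    rw [integral_add (hpI n) (integrable_finsetSum _ fun k _ => hRI k),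
      integral_finsetSum _ fun k _ => hRI k] at h1
    exact h1.trans (add_le_add (hB n)
      (hRs.sum_le_tsum _ fun k _ => integral_nonneg (hR0 k)))
  filter_upwards [hsuper.neg.exists_ae_tendsto_of_bdd hbdd,
    ae_summable_of_summable_integral hR0 hRI hRs] with ω ⟨c, hc⟩ hsum
  refine ⟨_, (hsum.hasSum.tendsto_sum_nat.sub hc).congr fun n => ?_⟩
  simp [hU, hp]

end SquareIntegrable

/-! ### Removing square integrability of the errors by truncation. -/

section Localization

variable {H : Type*} [NormedAddCommGroup H] [InnerProductSpace ℝ H] [CompleteSpace H]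
  {Ω : Type*} {mΩ : MeasurableSpace Ω} {P : Measure Ω}
  {f : H → ℝ} {L : ℝ≥0} {s : ℕ → ℝ} {α : ℝ} {ℱ : Filtration ℕ mΩ} {e x d : ℕ → Ω → H}

/-- The summability and quasi-Fejér properties of a path of the method, relative to a reference
minimizer `z`. -/
structure HasFejerBounds (f : H → ℝ) (s : ℕ → ℝ) (α : ℝ) (z : H) (x d : ℕ → H) : Prop where
  summable_gap : Summable fun k => s k * (f (x k + α • d k) - f z)
  summable_momentum : Summable fun k => ‖d k‖ ^ 2
  summable_gradient : Summable fun k => ‖s k • gradient f (x k + α • d k)‖ ^ 2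
  tendsto_dist : ∀ z' ∈ argminSet f,
    ∃ l, Tendsto (fun k => ‖x k + (α / (1 - α)) • d k - z'‖ ^ 2) atTop (𝓝 l)

theorem IsInertialPath.ae_hasFejerBounds [TopologicalSpace.SeparableSpace H] [IsFiniteMeasure P]
    (hconv : ConvexOn ℝ Set.univ f) (hdiff : Differentiable ℝ f)
    (hlip : LipschitzWith L (gradient f)) {z : H} (hz : z ∈ argminSet f)
    (hα₀ : 0 ≤ α) (hα₁ : α < 1) (hs_pos : ∀ k, 0 < s k) (hs_le : ∀ k, s k * L ≤ 1)
    (hs_anti : Antitone s)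
    (hpath : ∀ ω, IsInertialPath f s α (e · ω) (x · ω) (d · ω))
    (hx₀ : StronglyMeasurable[ℱ 0] (x 0)) (hx₀_sq : MemLp (x 0) 2 P)
    (he : ∀ k, StronglyMeasurable[ℱ (k + 1)] (e k)) (he_sq : ∀ k, MemLp (e k) 2 P)
    (he_mean : ∀ k, P[e k | ℱ k] =ᵐ[P] 0)
    (he_sum : Summable fun k => ∫ ω, ‖s k • e k ω‖ ^ 2 ∂P) :
    ∀ᵐ ω ∂P, HasFejerBounds f s α z (x · ω) (d · ω) := by
  have hd_sum := IsInertialPath.summable_integral_norm_sq hconv hdiff hlip hz hα₀ hα₁ hs_pos hs_le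
    hs_anti hpath hx₀ hx₀_sq he he_sq he_mean he_sum
  have hL := IsInertialPath.memLp hlip hpath hx₀_sq he_sq
  obtain ⟨D, hDS, hDc, hDd⟩ :=
    (TopologicalSpace.IsSeparable.of_separableSpace (argminSet f)).exists_countable_dense_subset
  have hanch : ∀ z' ∈ argminSet f, _ := fun z' hz' =>
    IsInertialPath.ae_anchor hconv hdiff hlip hz' hα₀ hα₁ hs_pos hpath hx₀ hx₀_sq he he_sq
      he_mean he_sum hd_sum
  have hD := (ae_ball_iff hDc).2 fun z' hz' => (hanch z' (hDS hz')).2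
  filter_upwards [(hanch z hz).1, hD,
    ae_summable_of_summable_integral (fun k ω => by positivity)
      (fun k => (hL k).2.integrable_norm_sq) hd_sum,
    ae_summable_of_summable_integral (fun k ω => by positivity)
      (fun k => ((he_sq k).const_smul (s k)).integrable_norm_sq) he_sum] with ω h1 h2 h3 h4
  refine ⟨h1, h3, ?_, exists_tendsto_norm_sub_sq_of_dense hDd h2⟩
  refine Summable.of_nonneg_of_le (fun k => by positivity)
    (fun k => norm_smul_gradient_sq_le hα₀ hα₁.le ((hpath ω).d_succ k)) ?_
  exact ((h3.add ((summable_nat_add_iff 1).2 h3)).add h4).mul_left 3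

/-- The pair (iterate, momentum) of the inertial method. -/
noncomputable def inertialState (f : H → ℝ) (s : ℕ → ℝ) (α : ℝ) (e : ℕ → H) (x₀ : H) : ℕ → H × H
  | 0 => (x₀, 0)
  | k + 1 =>
    let p := inertialState f s α e x₀ k
    let d' := α • p.2 - s k • (gradient f (p.1 + α • p.2) + e k)
    (p.1 + d', d')

theorem isInertialPath_inertialState (f : H → ℝ) (s : ℕ → ℝ) (α : ℝ) (e : ℕ → H) (x₀ : H) :
    IsInertialPath f s α e (fun k => (inertialState f s α e x₀ k).1)
      (fun k => (inertialState f s α e x₀ k).2) :=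
  ⟨rfl, fun _ => rfl, fun _ => rfl⟩

/-- Paths are determined by the initial point and the errors; this identifies the true path with the
truncated one wherever the errors agree. -/
theorem IsInertialPath.eq_inertialState {e x d : ℕ → H} (h : IsInertialPath f s α e x d) (k : ℕ) :
    inertialState f s α e (x 0) k = (x k, d k) := by
  induction k with
  | zero => rw [inertialState, h.d_zero]
  | succ k ih => rw [inertialState, ih, h.x_succ, h.d_succ]

theorem tsum_sq_lt_top {a : ℕ → ℝ≥0∞} (ha : ∑' k, a k < ∞) : ∑' k, a k ^ 2 < ∞ := by
  refine lt_of_le_of_lt ?_ (ENNReal.mul_lt_top ha ha)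
  rw [← ENNReal.tsum_mul_left]
  refine ENNReal.tsum_le_tsum fun k => ?_
  rw [sq]
  gcongr
  exact ENNReal.le_tsum k

/-- Truncating a nonnegative sequence when its partial sums exceed `N` leaves a total mass at
most `N`. -/
theorem tsum_indicator_partial_sum_le (q : ℕ → ℝ≥0∞) (N : ℝ≥0∞) :
    ∑' k, (if ∑ j ∈ Finset.range (k + 1), q j ≤ N then q k else 0) ≤ N := by
  rw [ENNReal.tsum_eq_iSup_nat]
  refine iSup_le fun n => ?_
  -- The bound `N` alone is not inductive: when `q n` is kept, the induction needs the bound by the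
  -- full partial sum.
  suffices h : ∑ k ∈ Finset.range n, (if ∑ j ∈ Finset.range (k + 1), q j ≤ N then q k else 0) ≤
      min N (∑ k ∈ Finset.range n, q k) from h.trans (min_le_left _ _)
  induction n with
  | zero => simp
  | succ n ih =>
    rw [Finset.sum_range_succ]
    split_ifs with h
    · refine le_min ?_ ?_
      · refine le_trans ?_ h
        rw [Finset.sum_range_succ]
        exact add_le_add_left (ih.trans (min_le_right _ _)) _
      · rw [Finset.sum_range_succ]
        exact add_le_add_left (ih.trans (min_le_right _ _)) _
    · rw [add_zero]
      refine ih.trans (min_le_min le_rfl ?_)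
      exact Finset.sum_le_sum_of_subset (Finset.range_mono n.le_succ)

omit [InnerProductSpace ℝ H] [CompleteSpace H] in
theorem memLp_two_of_lintegral_enorm_sq {v : Ω → H} (hv : AEStronglyMeasurable v P)
    (h : ∫⁻ ω, ‖v ω‖ₑ ^ 2 ∂P < ∞) : MemLp v 2 P := by
  rw [memLp_two_iff_integrable_sq_norm hv]
  refine ⟨(hv.norm.pow 2), ?_⟩
  rw [HasFiniteIntegral]
  simpa using h

omit [InnerProductSpace ℝ H] [CompleteSpace H] in
theorem integral_norm_sq_eq_toReal {v : Ω → H} (hv : AEStronglyMeasurable v P) :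
    ∫ ω, ‖v ω‖ ^ 2 ∂P = (∫⁻ ω, ‖v ω‖ₑ ^ 2 ∂P).toReal := by
  rw [integral_eq_lintegral_of_nonneg_ae (ae_of_all _ fun ω => by positivity)
    (show AEStronglyMeasurable (fun ω => ‖v ω‖ ^ 2) P from hv.norm.pow 2)]
  congr 2
  ext ω
  rw [ENNReal.ofReal_pow (norm_nonneg _), ofReal_norm]

theorem IsInertialPath.ae_hasFejerBounds_of_condStd [TopologicalSpace.SeparableSpace H]
    [IsFiniteMeasure P]
    (hconv : ConvexOn ℝ Set.univ f) (hdiff : Differentiable ℝ f)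
    (hlip : LipschitzWith L (gradient f)) {z : H} (hz : z ∈ argminSet f)
    (hα₀ : 0 ≤ α) (hα₁ : α < 1) (hs_pos : ∀ k, 0 < s k) (hs_le : ∀ k, s k * L ≤ 1)
    (hs_anti : Antitone s)
    (hpath : ∀ ω, IsInertialPath f s α (e · ω) (x · ω) (d · ω))
    (hx₀ : StronglyMeasurable[ℱ 0] (x 0)) (hx₀_sq : MemLp (x 0) 2 P)
    (he : ∀ k, StronglyMeasurable[ℱ (k + 1)] (e k)) (he_int : ∀ k, Integrable (e k) P)
    (he_mean : ∀ k, P[e k | ℱ k] =ᵐ[P] 0)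
    (he_sum : ∀ᵐ ω ∂P, ∑' k, ENNReal.ofReal (s k) * condStd P (ℱ k) (e k) ω < ∞) :
    ∀ᵐ ω ∂P, HasFejerBounds f s α z (x · ω) (d · ω) := by
  classical
  set q : ℕ → Ω → ℝ≥0∞ := fun k ω =>
    ENNReal.ofReal (s k) ^ 2 * condLExp (ℱ k) P (fun ω' => ‖e k ω'‖ₑ ^ 2) ω with hq
  have hqm : ∀ k, Measurable[ℱ k] (q k) := fun k =>
    (measurable_condLExp (ℱ k) P _).const_mul _
  -- The sum includes index k and is still ℱ k-measurable, as `q k` is a conditional expectation.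
  -- Hence truncation preserves the zero conditional mean.
  set A : ℕ → ℕ → Set Ω := fun N k => {ω | ∑ j ∈ Finset.range (k + 1), q j ω ≤ N} with hA
  have hAm : ∀ N k, MeasurableSet[ℱ k] (A N k) := fun N k => by
    have h1 : Measurable[ℱ k] fun ω => ∑ j ∈ Finset.range (k + 1), q j ω :=
      Finset.measurable_fun_sum _ fun j hj =>
        (hqm j).mono (ℱ.mono (Nat.lt_succ_iff.1 (Finset.mem_range.1 hj))) le_rfl
    exact h1 measurableSet_Iic
  have hfin : ∀ᵐ ω ∂P, ∃ N : ℕ, ∀ k, ω ∈ A N k := by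
    filter_upwards [he_sum] with ω hω
    have h1 := tsum_sq_lt_top hω
    have h2 : ∀ k, (ENNReal.ofReal (s k) * condStd P (ℱ k) (e k) ω) ^ 2 = q k ω := fun k => by
      rw [mul_pow, condStd, ← ENNReal.rpow_natCast (_ ^ (1 / 2 : ℝ)), ← ENNReal.rpow_mul]
      norm_num [hq]
    simp_rw [h2] at h1
    obtain ⟨N, hN⟩ := ENNReal.exists_nat_gt h1.ne
    exact ⟨N, fun k => (ENNReal.sum_le_tsum _).trans hN.le⟩
  suffices h : ∀ N : ℕ, ∀ᵐ ω ∂P, (∀ k, ω ∈ A N k) → HasFejerBounds f s α z (x · ω) (d · ω) by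
    filter_upwards [ae_all_iff.2 h, hfin] with ω h1 ⟨N, hN⟩ using h1 N hN
  intro N
  set e' : ℕ → Ω → H := fun k => (A N k).indicator (e k) with he'
  have he'm : ∀ k, StronglyMeasurable[ℱ (k + 1)] (e' k) := fun k =>
    (he k).indicator (ℱ.mono k.le_succ _ (hAm N k))
  have he'a : ∀ k, AEStronglyMeasurable (e' k) P := fun k =>
    ((he'm k).mono (ℱ.le _)).aestronglyMeasurable
  have hind : ∀ k, (fun ω => if ∑ j ∈ Finset.range (k + 1), q j ω ≤ N then q k ω else 0) =
      (A N k).indicator (q k) := fun k => by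
    ext ω
    simp [Set.indicator, hA]
  have hlint : ∀ k, ENNReal.ofReal (s k) ^ 2 * ∫⁻ ω, ‖e' k ω‖ₑ ^ 2 ∂P =
      ∫⁻ ω, (if ∑ j ∈ Finset.range (k + 1), q j ω ≤ N then q k ω else 0) ∂P := by
    intro k
    have hAk := ℱ.le k _ (hAm N k)
    have h1 : ∀ ω, ‖e' k ω‖ₑ ^ 2 = (A N k).indicator (fun ω => ‖e k ω‖ₑ ^ 2) ω := fun ω => by
      by_cases hω : ω ∈ A N k <;> simp [he', hω]
    rw [hind k]
    simp_rw [h1]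
    rw [lintegral_indicator hAk, lintegral_indicator hAk, hq,
      lintegral_const_mul _ (measurable_condLExp' _ _ _),
      setLIntegral_condLExp (ℱ.le k) P _ (hAm N k)]
  have htot : ∑' k, ENNReal.ofReal (s k) ^ 2 * ∫⁻ ω, ‖e' k ω‖ₑ ^ 2 ∂P < ∞ := by
    simp_rw [hlint]
    rw [← lintegral_tsum fun k => ?_]
    · refine (lintegral_mono fun ω => tsum_indicator_partial_sum_le (fun k => q k ω) N).trans_lt ?_
      rw [lintegral_const]
      exact ENNReal.mul_lt_top (by simp) (measure_lt_top _ _)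
    · rw [hind k]
      exact (((hqm k).mono (ℱ.le k) le_rfl).indicator (ℱ.le k _ (hAm N k))).aemeasurable
  have he'2 : ∀ k, MemLp (e' k) 2 P := fun k => by
    refine memLp_two_of_lintegral_enorm_sq (he'a k) ?_
    have h1 := (ENNReal.le_tsum k).trans_lt htot
    -- Positivity of the step turns finiteness of the weighted second moment into square
    -- integrability.
    have h2 : ENNReal.ofReal (s k) ^ 2 ≠ 0 := by
      have := hs_pos k
      simpa using this
    exact ENNReal.lt_top_of_mul_ne_top_right h1.ne h2
  have he'mean : ∀ k, P[e' k | ℱ k] =ᵐ[P] 0 := fun k => by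
    filter_upwards [condExp_indicator (he_int k) (hAm N k), he_mean k] with ω h1 h2
    rw [h1]
    by_cases hω : ω ∈ A N k <;> simp [hω, h2]
  have he'sum : Summable fun k => ∫ ω, ‖s k • e' k ω‖ ^ 2 ∂P := by
    refine (ENNReal.summable_toReal htot.ne).congr fun k => ?_
    simp_rw [norm_smul, mul_pow]
    rw [integral_const_mul, integral_norm_sq_eq_toReal (he'a k), ENNReal.toReal_mul,
      ENNReal.toReal_pow, ENNReal.toReal_ofReal (hs_pos k).le, Real.norm_of_nonneg (hs_pos k).le]
  -- The path is rerun with truncated errors but the filtration is kept.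
  have key := IsInertialPath.ae_hasFejerBounds (ℱ := ℱ) (P := P) (e := e')
    (x := fun k ω => (inertialState f s α (e' · ω) (x 0 ω) k).1)
    (d := fun k ω => (inertialState f s α (e' · ω) (x 0 ω) k).2)
    hconv hdiff hlip hz hα₀ hα₁ hs_pos hs_le hs_anti
    (fun ω => isInertialPath_inertialState f s α _ _) hx₀ hx₀_sq he'm he'2 he'mean he'sum
  filter_upwards [key] with ω hω hωA
  have h1 : (fun k => e' k ω) = fun k => e k ω := funext fun k => by simp [he', hωA k]
  rw [h1] at hω
  simpa only [(hpath ω).eq_inertialState] using hω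

end Localization

/-! ### Pathwise consequences and the passage from Ravine to inertial form. -/

section Conclusion

variable {H : Type*} [NormedAddCommGroup H] [InnerProductSpace ℝ H] [CompleteSpace H]
  {f : H → ℝ} {s : ℕ → ℝ} {α : ℝ} {z : H} {e x d : ℕ → H}

theorem HasFejerBounds.summable_norm_sub_sq (hα₀ : 0 ≤ α) (hα₁ : α < 1)
    (hpath : IsInertialPath f s α e x d) (h : HasFejerBounds f s α z x d) :
    Summable fun k => ‖(x (k + 1) + α • d (k + 1)) - (x k + α • d k)‖ ^ 2 := by
  have h1 := h.summable_momentum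
  refine Summable.of_nonneg_of_le (fun k => by positivity) (fun k => ?_)
    ((((((summable_nat_add_iff 1).2 h1).mul_left 2).add h1).mul_left 3))
  have e1 : (x (k + 1) + α • d (k + 1)) - (x k + α • d k) =
      d (k + 1) - α • d k - α • (-d (k + 1)) := by
    rw [hpath.x_succ, smul_neg]; abel
  rw [e1]
  have h2 := norm_sq_add_three_le (d (k + 1)) (α • d k) (α • (-d (k + 1)))
  have h3 := norm_smul_sq_le_of_abs_le_one hα₀ hα₁.le (d k)
  have h4 := norm_smul_sq_le_of_abs_le_one hα₀ hα₁.le (-d (k + 1))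
  rw [norm_neg] at h4
  linarith

theorem HasFejerBounds.summable_gradient_sq {c : ℝ} (hc : 0 < c) (hcs : ∀ k, c ≤ s k)
    (h : HasFejerBounds f s α z x d) :
    Summable fun k => ‖gradient f (x k + α • d k)‖ ^ 2 := by
  refine Summable.of_nonneg_of_le (fun k => by positivity) (fun k => ?_)
    (h.summable_gradient.mul_left (1 / c ^ 2))
  rw [norm_smul, mul_pow, ← mul_assoc, Real.norm_of_nonneg (hc.le.trans (hcs k))]
  refine le_mul_of_one_le_left (by positivity) ?_
  rw [one_div, inv_mul_eq_div, one_le_div (by positivity)]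
  exact pow_le_pow_left₀ hc.le (hcs k) 2

theorem HasFejerBounds.exists_weaklyConverges [TopologicalSpace.SeparableSpace H]
    (hconv : ConvexOn ℝ Set.univ f) (hdiff : Differentiable ℝ f) (hz : z ∈ argminSet f)
    {c : ℝ} (hc : 0 < c) (hcs : ∀ k, c ≤ s k) (h : HasFejerBounds f s α z x d) :
    ∃ x' ∈ argminSet f, WeaklyConverges (fun k => x k + α • d k) x' := by
  have hfy : Tendsto (fun k => f (x k + α • d k)) atTop (𝓝 (f z)) := by
    have h1 : Tendsto (fun k => 1 / c * (s k * (f (x k + α • d k) - f z))) atTop (𝓝 0) := by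
      simpa using h.summable_gap.tendsto_atTop_zero.const_mul (1 / c)
    have h2 : Tendsto (fun k => f (x k + α • d k) - f z) atTop (𝓝 0) := by
      refine squeeze_zero (fun k => sub_nonneg.2 (hz _)) (fun k => ?_) h1
      rw [one_div, ← mul_assoc]
      refine le_mul_of_one_le_left (sub_nonneg.2 (hz _)) ?_
      rw [inv_mul_eq_div, one_le_div hc]
      exact hcs k
    simpa using h2.add_const (f z)
  have hd : Tendsto d atTop (𝓝 0) := by
    rw [tendsto_zero_iff_norm_tendsto_zero]
    have := h.summable_momentum.tendsto_atTop_zero.sqrt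
    simpa [Real.sqrt_sq] using this
  -- The anchored point and y_k differ by a multiple of d_k → 0, so they share weak limits along
  -- subsequences.
  have htrans : ∀ (φ : ℕ → ℕ) (v : H), Tendsto φ atTop atTop →
      (∀ w, Tendsto (fun k => inner ℝ (x (φ k) + (α / (1 - α)) • d (φ k)) w) atTop
        (𝓝 (inner ℝ v w))) →
      ∀ w, Tendsto (fun k => inner ℝ (x (φ k) + α • d (φ k)) w) atTop (𝓝 (inner ℝ v w)) := by
    intro φ v hφ hv w
    have h1 : Tendsto (fun k => inner ℝ ((α - α / (1 - α)) • d (φ k)) w) atTop (𝓝 0) := by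
      have h2 := ((hd.comp hφ).const_smul (α - α / (1 - α))).inner (𝕜 := ℝ)
        (tendsto_const_nhds (x := w))
      simpa using h2
    have h3 := (hv w).add h1
    rw [add_zero] at h3
    refine h3.congr fun k => ?_
    rw [← inner_add_left, sub_smul]
    congr 1
    abel
  obtain ⟨x', hx', hlim⟩ := opial (u := fun k => x k + (α / (1 - α)) • d k) ⟨z, hz⟩ h.tendsto_dist
    fun v φ hφ hv => mem_argminSet_of_weak_limit hconv hdiff hz (htrans φ v hφ hv) (hfy.comp hφ)
  exact ⟨x', hx', weaklyConverges_iff_forall_inner.2 (htrans id x' tendsto_id hlim)⟩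

theorem IsRavineTrajectory.exists_isInertialPath {y w : ℕ → H}
    (h : IsRavineTrajectory f s (fun _ => α) e y w) :
    ∃ d, IsInertialPath f s α e (prevIterate (y 0) w) d ∧
      ∀ k, y k = prevIterate (y 0) w k + α • d k := by
  let d : ℕ → H := fun k => Nat.casesOn k 0 fun k => w k - prevIterate (y 0) w k
  have hy : ∀ k, y k = prevIterate (y 0) w k + α • d k := by
    intro k
    cases k with
    | zero => simp [d, prevIterate]
    | succ k => exact h.extrapolation k
  refine ⟨d, ⟨rfl, fun k => ?_, fun k => ?_⟩, hy⟩
  · change w k - prevIterate (y 0) w k = _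
    rw [h.gradient_step k, ← hy k]
    nth_rw 1 [hy k]
    abel
  · change w k = _ + (w k - prevIterate (y 0) w k)
    abel

end Conclusion

/-! ### Measurability with respect to the canonical filtration. -/

section RavineFiltration

/-- The canonical filtration of the method. -/
def ravineFiltration {Ω H : Type*} [mΩ : MeasurableSpace Ω] [MeasurableSpace H] {y₀ : Ω → H}
    {w : ℕ → Ω → H} (hy₀ : Measurable y₀) (hw : ∀ k, Measurable (w k)) : Filtration ℕ mΩ where
  seq := ravineSigma y₀ w
  mono' := fun _ _ hij => sup_le_sup le_rfl
    (iSup_le fun k => le_iSup_of_le (Fin.castLE hij k) le_rfl)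
  le' := fun _ => sup_le hy₀.comap_le (iSup_le fun k => (hw k).comap_le)

theorem measurable_initial_ravineFiltration {Ω H : Type*} [MeasurableSpace Ω] [MeasurableSpace H]
    {y₀ : Ω → H} {w : ℕ → Ω → H} {hy₀ : Measurable y₀} {hw : ∀ k, Measurable (w k)} (k : ℕ) :
    Measurable[ravineFiltration hy₀ hw k] y₀ :=
  Measurable.of_comap_le le_sup_left

theorem measurable_iterate_ravineFiltration {Ω H : Type*} [MeasurableSpace Ω] [MeasurableSpace H]
    {y₀ : Ω → H} {w : ℕ → Ω → H} {hy₀ : Measurable y₀} {hw : ∀ k, Measurable (w k)} {j k : ℕ} (hjk : j < k) :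
    Measurable[ravineFiltration hy₀ hw k] (w j) :=
  Measurable.of_comap_le (le_sup_of_le_right
    (le_iSup_of_le (f := fun i : Fin k => MeasurableSpace.comap (w i) inferInstance)
      ⟨j, hjk⟩ le_rfl))

variable {H : Type*} [NormedAddCommGroup H] [InnerProductSpace ℝ H] [CompleteSpace H]
  [TopologicalSpace.SeparableSpace H] [MeasurableSpace H] [BorelSpace H]
  {Ω : Type*} [mΩ : MeasurableSpace Ω] {f : H → ℝ} {s α : ℕ → ℝ} {e y w : ℕ → Ω → H}

theorem IsRavineTrajectory.measurable (hgrad : Continuous (gradient f))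
    (he : ∀ k, Measurable (e k)) (hy₀ : Measurable (y 0))
    (halg : ∀ ω, IsRavineTrajectory f s α (e · ω) (y · ω) (w · ω)) (k : ℕ) :
    Measurable (y k) ∧ Measurable (w k) := by
  have : SecondCountableTopology H := UniformSpace.secondCountable_of_separable H
  have hw : ∀ k, Measurable (y k) → Measurable (w k) := fun k hk => by
    rw [show w k = fun ω => y k ω - s k • (gradient f (y k ω) + e k ω) from
      funext fun ω => (halg ω).gradient_step k]
    exact hk.sub (((hgrad.measurable.comp hk).add (he k)).const_smul (s k))
  have hstep : ∀ k, Measurable (w k) →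
      Measurable (fun ω => prevIterate (y 0 ω) (w · ω) k) → Measurable (y (k + 1)) :=
    fun k hk hp => by
    rw [show y (k + 1) = fun ω => w k ω + α (k + 1) • (w k ω - prevIterate (y 0 ω) (w · ω) k) from
      funext fun ω => (halg ω).extrapolation k]
    exact hk.add ((hk.sub hp).const_smul _)
  suffices h : Measurable (y k) ∧ Measurable (fun ω => prevIterate (y 0 ω) (w · ω) k) from
    ⟨h.1, hw k h.1⟩
  induction k with
  | zero => exact ⟨hy₀, hy₀⟩
  | succ k ih => exact ⟨hstep k (hw k ih.1) ih.2, hw k ih.1⟩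

variable {hy₀ : Measurable (y 0)} {hw : ∀ k, Measurable (w k)}

/-- Since s_k ≠ 0, the gradient step can be solved for e_k in terms of y_k and w_k, and y_k is a
function of y_0 and earlier w's. -/
theorem stronglyMeasurable_error_ravineFiltration (hgrad : Continuous (gradient f))
    (hs : ∀ k, 0 < s k)
    (halg : ∀ ω, IsRavineTrajectory f s α (e · ω) (y · ω) (w · ω)) (k : ℕ) :
    StronglyMeasurable[ravineFiltration hy₀ hw (k + 1)] (e k) := by
  have : SecondCountableTopology H := UniformSpace.secondCountable_of_separable H
  have hwm : ∀ {j}, j ≤ k → StronglyMeasurable[ravineFiltration hy₀ hw (k + 1)] (w j) :=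
    fun hj => (measurable_iterate_ravineFiltration (Nat.lt_succ_of_le hj)).stronglyMeasurable
  have hy0 : StronglyMeasurable[ravineFiltration hy₀ hw (k + 1)] (y 0) :=
    (measurable_initial_ravineFiltration _).stronglyMeasurable
  have hym : StronglyMeasurable[ravineFiltration hy₀ hw (k + 1)] (y k) := by
    cases k with
    | zero => exact hy0
    | succ k =>
      have hp : StronglyMeasurable[ravineFiltration hy₀ hw (k + 2)]
          fun ω => prevIterate (y 0 ω) (w · ω) k := by
        cases k with
        | zero => exact hy0
        | succ k => exact hwm (by omega)
      rw [show y (k + 1) = fun ω => w k ω + α (k + 1) • (w k ω - prevIterate (y 0 ω) (w · ω) k) from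
        funext fun ω => (halg ω).extrapolation k]
      exact (hwm k.le_succ).add (((hwm k.le_succ).sub hp).const_smul _)
  have he : e k = fun ω => (s k)⁻¹ • (y k ω - w k ω) - gradient f (y k ω) := funext fun ω => by
    rw [(halg ω).gradient_step k, sub_sub_cancel, inv_smul_smul₀ (hs k).ne', add_sub_cancel_left]
  rw [he]
  exact ((hym.sub (hwm le_rfl)).const_smul _).sub (hgrad.comp_stronglyMeasurable hym)

end RavineFiltration

theorem corollary5p3
    {H : Type*} [NormedAddCommGroup H] [InnerProductSpace ℝ H] [CompleteSpace H]
    [TopologicalSpace.SeparableSpace H] [MeasurableSpace H] [BorelSpace H]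
    {Ω : Type*} [MeasurableSpace Ω] (P : Measure Ω) [IsProbabilityMeasure P]
    -- the objective: convex, differentiable, with `L`-Lipschitz gradient and a minimizer
    (f : H → ℝ) (L : ℝ≥0) (hL : 0 < L)
    (hconv : ConvexOn ℝ Set.univ f) (hdiff : Differentiable ℝ f)
    (hlip : LipschitzWith L (gradient f)) (hargmin : (argminSet f).Nonempty)
    -- the deterministic parameters
    (α : ℝ) (hα₀ : 0 ≤ α) (hα₁ : α < 1)
    (s : ℕ → ℝ) (hs_pos : ∀ k, 0 < s k) (hs_le : ∀ k, s k ≤ 1 / (L : ℝ)) (hs_anti : Antitone s)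
    -- the errors and the iterates of the method with constant extrapolation coefficient
    (e y w : ℕ → Ω → H) (he_meas : ∀ k, Measurable (e k)) (he_int : ∀ k, Integrable (e k) P)
    (hy₀_meas : Measurable (y 0)) (hy₀_sq : MemLp (y 0) 2 P)
    (halg : ∀ ω, IsRavineTrajectory f s (fun _ => α)
      (fun k => e k ω) (fun k => y k ω) (fun k => w k ω))
    -- conditional unbiasedness and summability of `s k * σ k`
    (he_mean : ∀ k, P[e k | ravineSigma (y 0) w k] =ᵐ[P] 0)
    (he_sum : ∀ᵐ ω ∂P,
      ∑' k, ENNReal.ofReal (s k) * condStd P (ravineSigma (y 0) w k) (e k) ω < ∞) :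
    (∀ᵐ ω ∂P, Summable (fun k => s k * (f (y k ω) - minValue f)) ∧
      Summable (fun k => ‖y (k + 1) ω - y k ω‖ ^ 2)) ∧
    (0 < ⨅ k, s k →
      (∀ᵐ ω ∂P, Summable (fun k => ‖gradient f (y k ω)‖ ^ 2)) ∧
      ∃ X : Ω → H, Measurable X ∧ (∀ ω, X ω ∈ argminSet f) ∧
        ∀ᵐ ω ∂P, WeaklyConverges (fun k => y k ω) (X ω)) := by

  obtain ⟨z, hz⟩ := hargmin
  have hmeas := IsRavineTrajectory.measurable hlip.continuous he_meas hy₀_meas halg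
  choose d hpath hy using fun ω => (halg ω).exists_isInertialPath
  have hsL : ∀ k, s k * L ≤ 1 := fun k => (le_div_iff₀ (by exact_mod_cast hL)).1 (hs_le k)
  have hsecond : SecondCountableTopology H := UniformSpace.secondCountable_of_separable H
  have key : ∀ᵐ ω ∂P, HasFejerBounds f s α z (prevIterate (y 0 ω) (w · ω)) (d ω) :=
    IsInertialPath.ae_hasFejerBounds_of_condStd
      (ℱ := ravineFiltration hy₀_meas fun k => (hmeas k).2)
      (x := fun k ω => prevIterate (y 0 ω) (w · ω) k) (d := fun k ω => d ω k)
      hconv hdiff hlip hz hα₀ hα₁ hs_pos hsL hs_anti hpath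
      (measurable_initial_ravineFiltration 0).stronglyMeasurable hy₀_sq
      (stronglyMeasurable_error_ravineFiltration hlip.continuous hs_pos halg)
      he_int he_mean he_sum
  rw [minValue_eq_of_mem_argminSet hz]
  refine ⟨?_, fun hc => ?_⟩
  · filter_upwards [key] with ω hω
    exact ⟨hω.summable_gap.congr fun k => by rw [← hy ω k],
      (hω.summable_norm_sub_sq hα₀ hα₁ (hpath ω)).congr fun k => by
        rw [← hy ω k, ← hy ω (k + 1)]⟩
  · have hcs : ∀ k, ⨅ k, s k ≤ s k := ciInf_le ⟨0, by rintro _ ⟨k, rfl⟩; exact (hs_pos k).le⟩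
    refine ⟨?_, exists_measurable_weak_limit (fun k => (hmeas k).1) ⟨z, hz⟩ ?_⟩
    · filter_upwards [key] with ω hω
      exact (hω.summable_gradient_sq hc hcs).congr fun k => by rw [← hy ω k]
    · filter_upwards [key] with ω hω
      rw [show (fun k => y k ω) = fun k => prevIterate (y 0 ω) (w · ω) k + α • d ω k from
        funext (hy ω)]
      exact hω.exists_weaklyConverges hconv hdiff hz hc hcs
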